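/- Let $n_1,n_2,N,d_1,d_2,k,r_1,r_2$ be natural numbers with $1\le k\le\min\{n_1,n_2\}$, $n_1\le r_1$ and $n_2\le r_2$. Let $\mathcal A:\mathbb R^{n_1\times n_2}\to\mathbb R^N$ be linear, $b\in\mathbb R^N$, and let $X_r\in\mathbb R^{n_1\times d_1}$, $X_c\in\mathbb R^{n_2\times d_2}$ be feature matrices. For $f:\mathbb R^{d_1}\to\mathbb R$ write $f(X_r)\in\mathbb R^{n_1}$ for the vector of values of $f$ at the rows of $X_r$; for $f=(f_1,\dots,f_k)$ let $f(X_r)\in\mathbb R^{n_1\times k}$ have columns $f_i(X_r)$; similarly for $X_c$. Let $(\cdot)_+$ be the entrywise positive part. Let the link-function classes be $F_r=\{\varphi_r(\theta):\theta\in\mathbb R^{r_1}\}$ and $F_c=\{\varphi_c(\theta):\theta\in\mathbb R^{r_2}\}$, where $\varphi_r,\varphi_c$ are linear maps from the parameter spaces to the real functions on $\mathbb R^{d_1}$, $\mathbb R^{d_2}$, and suppose that the Jacobian matrices of $\theta\mapsto\varphi_r(\theta)(X_r)\in\mathbb R^{n_1}$ and $\theta\mapsto\varphi_c(\theta)(X_c)\in\mathbb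 R^{n_2}$ have full rank (that is, ranks $n_1$ and $n_2$). Consider the problem $$\min_{V,\ f_r\in F_r^k,\ f_c\in F_c^k}\ h(V,f_r,f_c)=\bigl\|V-(f_r(X_r))_+\,(f_c(X_c))_+^{T}\bigr\|_F^2\quad\text{subject to}\quad \mathcal A(V)=b,\ V\ge 0. \qquad(P)$$ The HALSX algorithm starts from arbitrary matrices $F_r^0\in\mathbb R_+^{n_1\times k}$, $F_c^0\in\mathbb R_+^{n_2\times k}$ (the $i$-th columns of $F_r^t$, $F_c^t$ are denoted $\mathbf f_{r,i}^t$, $\mathbf f_{c,i}^t$) and for $t=0,1,2,\dots$ does the following, where any minimizer may be taken if there are several: 1. $V^t\in\arg\min\{\|V-F_r^t(F_c^t)^T\|_F^2:\mathcal A(V)=b,\ V\ge0\}$ and $R:=V^t-F_r^t(F_c^t)^T$. 2. For $i=1,\dots,k$: $R_i:=R+\mathbf f_{r,i}^t(\mathbf f_{c,i}^t)^T$; $f_{r,i}^{t+1}\in\arg\min_{f\in F_r}\|R_i-f(X_r)(\mathbf f_{c,i}^t)^T\|_F^2$; $\mathbf f_{r,i}^{t+1}:=(f_{r,i}^{t+1}(X_r))_+$;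 $R:=R_i-\mathbf f_{r,i}^{t+1}(\mathbf f_{c,i}^t)^T$. 3. For $i=1,\dots,k$: $R_i:=R+\mathbf f_{r,i}^{t+1}(\mathbf f_{c,i}^t)^T$; $f_{c,i}^{t+1}\in\arg\min_{f\in F_c}\|R_i-\mathbf f_{r,i}^{t+1}f(X_c)^T\|_F^2$; $\mathbf f_{c,i}^{t+1}:=(f_{c,i}^{t+1}(X_c))_+$; $R:=R_i-\mathbf f_{r,i}^{t+1}(\mathbf f_{c,i}^{t+1})^T$. Call a feasible point $x$ of $(P)$ *critical* if for every feasible $y$ the one-sided directional derivative $\lim_{s\downarrow0}\bigl(h(x+s(y-x))-h(x)\bigr)/s$ exists and is $\ge0$. Then, for every infinite run of HALSX, every full-rank limit point is a critical point of $(P)$. Precisely: (a) If $(\bar V,\bar f_r,\bar f_c)$ is a limit point (for pointwise convergence of the link functions) of the sequence $(V^t,f_r^t,f_c^t)_{t\ge1}$ and the matrices $(\bar f_r(X_r))_+$ and $(\bar f_c(X_c))_+$ have full rank $k$, then $(\bar V,\bar f_r,\bar f_c)$ is a critical point of $(P)$. (b) If $(\bar V,\bar F_r,\bar F_c)$ is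 a limit point of the sequence $(V^t,F_r^t,F_c^t)$ and $\bar F_r,\bar F_c$ have full rank $k$, then there are $\bar f_r\in F_r^k$, $\bar f_c\in F_c^k$ with $(\bar f_r(X_r))_+=\bar F_r$ and $(\bar f_c(X_c))_+=\bar F_c$, and for all such $\bar f_r,\bar f_c$ the point $(\bar V,\bar f_r,\bar f_c)$ is a critical point of $(P)$. -/

import Mathlib

open Filter Topology

/-- The squared Frobenius norm of a real matrix. -/
def frobSq {m n : ℕ} (M : Matrix (Fin m) (Fin n) ℝ) : ℝ :=
  ∑ i, ∑ j, M i j ^ 2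

/-- A matrix is of full rank if its rank is the smaller one of its two dimensions. -/
def IsFullRank {m n : ℕ} (M : Matrix (Fin m) (Fin n) ℝ) : Prop :=
  M.rank = min m n

/-- The Jacobian matrix at `θ` of a function `g : ℝ^r → ℝ^n`. -/
noncomputable def jacobian {r n : ℕ} (g : (Fin r → ℝ) → (Fin n → ℝ)) (θ : Fin r → ℝ) :
    Matrix (Fin n) (Fin r) ℝ :=
  LinearMap.toMatrix' (fderiv ℝ g θ : (Fin r → ℝ) →ₗ[ℝ] (Fin n → ℝ))

/-- `f(X)`: the vector of the values of `f` at the rows of the feature matrix `X`. -/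
def evalRows {n d : ℕ} (X : Matrix (Fin n) (Fin d) ℝ) (f : (Fin d → ℝ) → ℝ) : Fin n → ℝ :=
  fun i => f (X i)

/-- `(f(X))₊` for `f = (f_1, …, f_k)`: the `n × k` matrix whose `j`-th column is the positive
part of the vector `f_j(X)`. -/
def factorMatrix {n d k : ℕ} (X : Matrix (Fin n) (Fin d) ℝ) (f : Fin k → (Fin d → ℝ) → ℝ) :
    Matrix (Fin n) (Fin k) ℝ :=
  Matrix.of fun i j => max 0 (evalRows X (f j) i)

/-- The matrices with `A V = b` and `V ≥ 0`. -/
def feasibleMatrices {n₁ n₂ N : ℕ} (A : Matrix (Fin n₁) (Fin n₂) ℝ →ₗ[ℝ] (Fin N → ℝ))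
    (b : Fin N → ℝ) : Set (Matrix (Fin n₁) (Fin n₂) ℝ) :=
  {V | A V = b ∧ ∀ i j, 0 ≤ V i j}

/-- The space of the variables `(V, f_r, f_c)` of the optimization problem, before the
constraints are imposed. -/
abbrev Variables (n₁ n₂ d₁ d₂ k : ℕ) : Type :=
  Matrix (Fin n₁) (Fin n₂) ℝ × (Fin k → (Fin d₁ → ℝ) → ℝ) × (Fin k → (Fin d₂ → ℝ) → ℝ)

/-- The objective function `‖V - (f_r(X_r))₊ (f_c(X_c))₊ᵀ‖_F²`. -/
def objective {n₁ n₂ d₁ d₂ k : ℕ}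
    (Xr : Matrix (Fin n₁) (Fin d₁) ℝ) (Xc : Matrix (Fin n₂) (Fin d₂) ℝ)
    (x : Variables n₁ n₂ d₁ d₂ k) : ℝ :=
  frobSq (x.1 - factorMatrix Xr x.2.1 * (factorMatrix Xc x.2.2).transpose)

/-- The feasible set of the optimization problem: `A V = b`, `V ≥ 0`, `f_r ∈ Sr^k`,
`f_c ∈ Sc^k`. -/
def feasibleSet {n₁ n₂ N d₁ d₂ : ℕ}
    (A : Matrix (Fin n₁) (Fin n₂) ℝ →ₗ[ℝ] (Fin N → ℝ)) (b : Fin N → ℝ)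
    (Sr : Set ((Fin d₁ → ℝ) → ℝ)) (Sc : Set ((Fin d₂ → ℝ) → ℝ)) (k : ℕ) :
    Set (Variables n₁ n₂ d₁ d₂ k) :=
  {x | x.1 ∈ feasibleMatrices A b ∧ (∀ i, x.2.1 i ∈ Sr) ∧ (∀ i, x.2.2 i ∈ Sc)}

/-- `x` is a critical (first-order stationary) point of the problem of minimizing `h` over the
convex set `C`: it is feasible, and for all feasible `y` the one-sided directional derivative of
`h` at `x` in the direction `y - x` exists and is nonnegative. For a differentiable `h` this is
the condition `⟨∇h(x), y - x⟩ ≥ 0` for all `y ∈ C`. -/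
def IsCriticalPointOn {E : Type*} [AddCommGroup E] [Module ℝ E] (h : E → ℝ) (C : Set E)
    (x : E) : Prop :=
  x ∈ C ∧ ∀ y ∈ C, ∃ D : ℝ, 0 ≤ D ∧
    Tendsto (fun s : ℝ => (h (x + s • (y - x)) - h x) / s) (𝓝[>] 0) (𝓝 D)

/-- `x` is one of the minimizers of `h` over the set `C`. -/
def IsArgminOn {α : Type*} (h : α → ℝ) (C : Set α) (x : α) : Prop :=
  x ∈ C ∧ IsMinOn h C x

/-- An infinite run of the HALSX algorithm, started at arbitrary nonnegative factor matrices
`Fr 0`, `Fc 0`. Wherever a minimizer is not unique, any one may be taken. -/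
structure HALSXRun {n₁ n₂ N d₁ d₂ : ℕ}
    (A : Matrix (Fin n₁) (Fin n₂) ℝ →ₗ[ℝ] (Fin N → ℝ)) (b : Fin N → ℝ)
    (Xr : Matrix (Fin n₁) (Fin d₁) ℝ) (Xc : Matrix (Fin n₂) (Fin d₂) ℝ)
    (Sr : Set ((Fin d₁ → ℝ) → ℝ)) (Sc : Set ((Fin d₂ → ℝ) → ℝ)) (k : ℕ) where
  /-- The matrices `V^t`. -/
  V : ℕ → Matrix (Fin n₁) (Fin n₂) ℝ
  /-- The row factor matrices `F_r^t`. -/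
  Fr : ℕ → Matrix (Fin n₁) (Fin k) ℝ
  /-- The column factor matrices `F_c^t`. -/
  Fc : ℕ → Matrix (Fin n₂) (Fin k) ℝ
  /-- The row link functions `f_{r,i}^t`. They are computed for `t ≥ 1`; the values at `t = 0`
  play no role. -/
  fr : ℕ → Fin k → (Fin d₁ → ℝ) → ℝ
  /-- The column link functions `f_{c,i}^t`, computed for `t ≥ 1`. -/
  fc : ℕ → Fin k → (Fin d₂ → ℝ) → ℝ
  /-- `Rr t i` is the residual matrix `R^t` after `i` passes through the first inner loop. -/
  Rr : ℕ → ℕ → Matrix (Fin n₁) (Fin n₂) ℝ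
  /-- `Rc t i` is the residual matrix `R^t` after `i` passes through the second inner loop. -/
  Rc : ℕ → ℕ → Matrix (Fin n₁) (Fin n₂) ℝ
  Fr_zero_nonneg : ∀ i j, 0 ≤ Fr 0 i j
  Fc_zero_nonneg : ∀ i j, 0 ≤ Fc 0 i j
  V_argmin : ∀ t, IsArgminOn (fun W => frobSq (W - Fr t * (Fc t).transpose))
    (feasibleMatrices A b) (V t)
  Rr_zero : ∀ t, Rr t 0 = V t - Fr t * (Fc t).transpose
  /-- `f_{r,i}^{t+1}` minimizes `‖R_i^t - f(X_r) (f_{c,i}^t)ᵀ‖_F²` over `f ∈ Sr`, where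
  `R_i^t = R^t + f_{r,i}^t (f_{c,i}^t)ᵀ`. -/
  fr_argmin : ∀ t (i : Fin k), IsArgminOn
    (fun f => frobSq ((Rr t i + Matrix.vecMulVec ((Fr t).col i) ((Fc t).col i))
      - Matrix.vecMulVec (evalRows Xr f) ((Fc t).col i))) Sr (fr (t + 1) i)
  Fr_succ : ∀ t, Fr (t + 1) = factorMatrix Xr (fr (t + 1))
  Rr_succ : ∀ t (i : Fin k), Rr t (i + 1) =
    (Rr t i + Matrix.vecMulVec ((Fr t).col i) ((Fc t).col i))
      - Matrix.vecMulVec ((Fr (t + 1)).col i) ((Fc t).col i)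
  Rc_zero : ∀ t, Rc t 0 = Rr t k
  /-- `f_{c,i}^{t+1}` minimizes `‖R_i^t - f_{r,i}^{t+1} f(X_c)ᵀ‖_F²` over `f ∈ Sc`, where
  `R_i^t = R^t + f_{r,i}^{t+1} (f_{c,i}^t)ᵀ`. -/
  fc_argmin : ∀ t (i : Fin k), IsArgminOn
    (fun f => frobSq ((Rc t i + Matrix.vecMulVec ((Fr (t + 1)).col i) ((Fc t).col i))
      - Matrix.vecMulVec ((Fr (t + 1)).col i) (evalRows Xc f))) Sc (fc (t + 1) i)
  Fc_succ : ∀ t, Fc (t + 1) = factorMatrix Xc (fc (t + 1))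
  Rc_succ : ∀ t (i : Fin k), Rc t (i + 1) =
    (Rc t i + Matrix.vecMulVec ((Fr (t + 1)).col i) ((Fc t).col i))
      - Matrix.vecMulVec ((Fr (t + 1)).col i) ((Fc (t + 1)).col i)

/-!
Since the Jacobian at the rows of the feature matrix has full row rank, a link function can attain
any vector there. Each rank-one regression is therefore an unconstrained least squares problem, and
the positive part of its solution solves the corresponding nonnegative least squares problem.

Let the update of a column `f` to `f'`, with fixed partner column `g`, change the residual from `R`
to `R' = R + (f - f') gᵀ`. The KKT conditions `R' g ≤ 0` and `f' · R' g = 0` give the sufficient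
decrease `‖R'‖² + |f - f'|² |g|² ≤ ‖R‖²`. The objective is bounded below, so all these decreases
tend to zero. Near a limit point whose factors have no zero column this forces `f - f' → 0`, so the
residual does not change in the limit during a sweep, and the KKT conditions of all columns hold
simultaneously for the limit residual.

Along a segment of feasible points every entry `max 0 (u + s d)` is affine in `s` for small `s > 0`,
with nonnegative slope where it vanishes at `s = 0`. The directional derivative of the objective is
thus the sum of a term that is nonnegative by the optimality of `V` and two terms that are
nonnegative by the KKT conditions.
-/

open Matrix

@[fun_prop]
lemma continuous_matrix_col {m n α : Type*} [TopologicalSpace α] (j : n) :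
    Continuous fun M : Matrix m n α => M.col j :=
  continuous_pi fun i => continuous_apply_apply i j

section Frobenius

variable {m n : ℕ}

lemma frobSq_nonneg (M : Matrix (Fin m) (Fin n) ℝ) : 0 ≤ frobSq M :=
  Finset.sum_nonneg fun _ _ => Finset.sum_nonneg fun _ _ => sq_nonneg _

lemma frobSq_eq_trace (M : Matrix (Fin m) (Fin n) ℝ) : frobSq M = (Mᵀ * M).trace := by
  simp only [frobSq, trace, diag_apply, mul_apply, transpose_apply, sq]
  exact Finset.sum_comm

lemma frobSq_transpose (M : Matrix (Fin m) (Fin n) ℝ) : frobSq Mᵀ = frobSq M :=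
  Finset.sum_comm

lemma trace_transpose_mul_swap (M P : Matrix (Fin m) (Fin n) ℝ) :
    (Mᵀ * P).trace = (Pᵀ * M).trace := by
  rw [← trace_transpose, transpose_mul, transpose_transpose]

lemma frobSq_add (M P : Matrix (Fin m) (Fin n) ℝ) :
    frobSq (M + P) = frobSq M + 2 * (Mᵀ * P).trace + frobSq P := by
  simp only [frobSq_eq_trace, transpose_add, Matrix.add_mul, Matrix.mul_add, trace_add,
    trace_transpose_mul_swap P M]
  ring

lemma frobSq_smul (s : ℝ) (M : Matrix (Fin m) (Fin n) ℝ) : frobSq (s • M) = s ^ 2 * frobSq M := by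
  simp only [frobSq_eq_trace, transpose_smul, Matrix.smul_mul, Matrix.mul_smul, trace_smul,
    smul_eq_mul]
  ring

lemma frobSq_vecMulVec (u : Fin m → ℝ) (c : Fin n → ℝ) :
    frobSq (vecMulVec u c) = (u ⬝ᵥ u) * (c ⬝ᵥ c) := by
  rw [frobSq_eq_trace, transpose_vecMulVec, vecMulVec_mul_vecMulVec, trace_vecMulVec,
    dotProduct_smul, smul_eq_mul]

lemma trace_transpose_mul_vecMulVec (M : Matrix (Fin m) (Fin n) ℝ) (u : Fin m → ℝ)
    (c : Fin n → ℝ) : (Mᵀ * vecMulVec u c).trace = u ⬝ᵥ M *ᵥ c := by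
  rw [mul_vecMulVec, trace_vecMulVec, mulVec_transpose, dotProduct_mulVec]

lemma continuous_frobSq : Continuous (frobSq : Matrix (Fin m) (Fin n) ℝ → ℝ) := by
  simp only [funext frobSq_eq_trace]
  fun_prop

lemma tendsto_frobSq_slope (R : Matrix (Fin m) (Fin n) ℝ) {P : ℝ → Matrix (Fin m) (Fin n) ℝ}
    {Q : Matrix (Fin m) (Fin n) ℝ} (hP : Tendsto P (𝓝[>] 0) (𝓝 Q)) :
    Tendsto (fun s => (frobSq (R + s • P s) - frobSq R) / s) (𝓝[>] 0)
      (𝓝 (2 * (Rᵀ * Q).trace)) := by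
  have hlin : Continuous fun M : Matrix (Fin m) (Fin n) ℝ => 2 * (Rᵀ * M).trace := by fun_prop
  have hs : Tendsto (fun s : ℝ => s) (𝓝[>] 0) (𝓝 0) := nhdsWithin_le_nhds
  have hlim := ((hlin.tendsto Q).comp hP).add (hs.mul ((continuous_frobSq.tendsto Q).comp hP))
  rw [zero_mul, add_zero] at hlim
  refine hlim.congr' ?_
  filter_upwards [self_mem_nhdsWithin] with s hs
  have hs0 : s ≠ 0 := ne_of_gt hs
  simp only [Function.comp_apply, frobSq_add, frobSq_smul, Matrix.mul_smul, trace_smul,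
    smul_eq_mul]
  field_simp
  ring

lemma trace_transpose_mul_nonneg_of_frobSq_le {R P : Matrix (Fin m) (Fin n) ℝ}
    (h : ∀ᶠ s : ℝ in 𝓝[>] 0, frobSq R ≤ frobSq (R + s • P)) : 0 ≤ (Rᵀ * P).trace := by
  suffices 0 ≤ 2 * (Rᵀ * P).trace by linarith
  refine ge_of_tendsto (tendsto_frobSq_slope R tendsto_const_nhds) ?_
  filter_upwards [h, self_mem_nhdsWithin] with s hs hs0
  exact div_nonneg (sub_nonneg.2 hs) (le_of_lt hs0)

lemma trace_nonneg_of_isArgminOn {C : Set (Matrix (Fin m) (Fin n) ℝ)} (hC : Convex ℝ C)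
    {M V W : Matrix (Fin m) (Fin n) ℝ} (hV : IsArgminOn (fun U => frobSq (U - M)) C V)
    (hW : W ∈ C) : 0 ≤ ((V - M)ᵀ * (W - V)).trace := by
  refine trace_transpose_mul_nonneg_of_frobSq_le ?_
  filter_upwards [Ioc_mem_nhdsGT (zero_lt_one' ℝ)] with s hs
  rw [← add_sub_right_comm]
  exact hV.2 (hC.add_smul_sub_mem hV.1 hW ⟨hs.1.le, hs.2⟩)

end Frobenius

section RankOneLeastSquares

variable {m n : ℕ} {Q : Matrix (Fin m) (Fin n) ℝ} {u : Fin m → ℝ} {c : Fin n → ℝ}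

lemma sub_vecMulVec_mulVec_eq_zero_of_isMinOn
    (h : IsMinOn (fun w => frobSq (Q - vecMulVec w c)) Set.univ u) :
    (Q - vecMulVec u c) *ᵥ c = 0 := by
  set g := (Q - vecMulVec u c) *ᵥ c with hg
  have hdir : 0 ≤ ((Q - vecMulVec u c)ᵀ * vecMulVec (-g) c).trace := by
    refine trace_transpose_mul_nonneg_of_frobSq_le (Eventually.of_forall fun s => ?_)
    have hmove : Q - vecMulVec u c + s • vecMulVec (-g) c = Q - vecMulVec (u - s • -g) c := by
      rw [sub_vecMulVec, smul_vecMulVec, sub_sub_eq_add_sub, sub_add_eq_add_sub]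
    rw [hmove]
    exact h (Set.mem_univ _)
  rw [trace_transpose_mul_vecMulVec, ← hg, neg_dotProduct, neg_nonneg] at hdir
  exact dotProduct_self_eq_zero.1 (hdir.antisymm (dotProduct_self_star_nonneg g))

/- With `v = u₊`, the normal equations for `u` turn the vector below into `|c|² (u - u₊)`, whose
entries are nonpositive and vanish where `u > 0`. -/
lemma posPart_complementary_of_isMinOn
    (h : IsMinOn (fun w => frobSq (Q - vecMulVec w c)) Set.univ u) {v : Fin m → ℝ}
    (hv : ∀ a, v a = max 0 (u a)) (a : Fin m) :
    ((Q - vecMulVec v c) *ᵥ c) a ≤ 0 ∧ v a * ((Q - vecMulVec v c) *ᵥ c) a = 0 := by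
  have hgrad : (Q - vecMulVec v c) *ᵥ c = (c ⬝ᵥ c) • (u - v) := by
    rw [← sub_add_sub_cancel Q (vecMulVec u c), add_mulVec,
      sub_vecMulVec_mulVec_eq_zero_of_isMinOn h, zero_add, ← sub_vecMulVec, vecMulVec_mulVec,
      op_smul_eq_smul]
  have hcc : 0 ≤ c ⬝ᵥ c := dotProduct_self_star_nonneg c
  rw [hgrad, Pi.smul_apply, Pi.sub_apply, smul_eq_mul, hv]
  rcases le_total 0 (u a) with hu | hu
  · simp [max_eq_right hu]
  · simpa [max_eq_left hu] using mul_nonpos_of_nonneg_of_nonpos hcc hu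

end RankOneLeastSquares

section Sweep

variable {m n k : ℕ}

/-- The KKT conditions (dual feasibility and complementary slackness) of the nonnegative least
squares problem of minimizing `‖W - F Gᵀ‖_F²` over `F ≥ 0`. They are expressed by the residual
`R = W - F Gᵀ`, the gradient with respect to `F` being `-2 R G`. -/
def IsKKT (R : Matrix (Fin m) (Fin n) ℝ) (F : Matrix (Fin m) (Fin k) ℝ)
    (G : Matrix (Fin n) (Fin k) ℝ) : Prop :=
  ∀ a i, (R * G) a i ≤ 0 ∧ F a i * (R * G) a i = 0

/-- One pass over the columns of the factor `F`, which becomes `F'`, while the factor `G` is fixed.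
`R i` is the residual after `i` columns have been updated; each new column satisfies the KKT
conditions of its own nonnegative least squares problem at the moment of its update. -/
structure IsHALSSweep (R : ℕ → Matrix (Fin m) (Fin n) ℝ) (F F' : Matrix (Fin m) (Fin k) ℝ)
    (G : Matrix (Fin n) (Fin k) ℝ) : Prop where
  nonneg : ∀ a i, 0 ≤ F a i
  residual_succ : ∀ i : Fin k, R (i + 1) = R i + vecMulVec (F.col i - F'.col i) (G.col i)
  kkt : ∀ (i : Fin k) a, (R (i + 1) * G) a i ≤ 0 ∧ F' a i * (R (i + 1) * G) a i = 0

namespace IsHALSSweep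

section Descent

variable {R : ℕ → Matrix (Fin m) (Fin n) ℝ} {F F' : Matrix (Fin m) (Fin k) ℝ}
  {G : Matrix (Fin n) (Fin k) ℝ}

lemma of_isMinOn {U : Fin k → Fin m → ℝ} (hF : ∀ a i, 0 ≤ F a i)
    (hU : ∀ i : Fin k, IsMinOn (fun w => frobSq
      ((R i + vecMulVec (F.col i) (G.col i)) - vecMulVec w (G.col i))) Set.univ (U i))
    (hF' : ∀ a i, F' a i = max 0 (U i a))
    (hR : ∀ i : Fin k, R (i + 1) =
      (R i + vecMulVec (F.col i) (G.col i)) - vecMulVec (F'.col i) (G.col i)) :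
    IsHALSSweep R F F' G where
  nonneg := hF
  residual_succ i := by rw [hR i, sub_vecMulVec, add_sub_assoc]
  kkt i a := by
    rw [hR i]
    exact posPart_complementary_of_isMinOn (hU i) (fun a => hF' a i) a

lemma residual_last (h : IsHALSSweep R F F' G) : R k = R 0 + (F - F') * Gᵀ := by
  have htelescope : ∑ i : Fin k, (R (i + 1) - R i) = R k - R 0 := by
    rw [Fin.sum_univ_eq_sum_range (fun i => R (i + 1) - R i), Finset.sum_range_sub]
  rw [← sub_eq_iff_eq_add', ← htelescope]
  ext a b
  simp [h.residual_succ, Matrix.sum_apply, mul_apply, vecMulVec_apply]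

/- The cross term of the expanded square is `∑ₐ (F' - F)ₐᵢ (R (i + 1) G)ₐᵢ`; it is nonnegative by
complementary slackness. -/
lemma frobSq_succ_add_le (h : IsHALSSweep R F F' G) (i : Fin k) :
    frobSq (R (i + 1)) + ((F.col i - F'.col i) ⬝ᵥ (F.col i - F'.col i)) * (G.col i ⬝ᵥ G.col i)
      ≤ frobSq (R i) := by
  have hcross : 0 ≤ (F'.col i - F.col i) ⬝ᵥ R (i + 1) *ᵥ G.col i :=
    Finset.sum_nonneg fun a _ => by
      have hslack : (F' a i - F a i) * (R (i + 1) * G) a i = -(F a i * (R (i + 1) * G) a i) := by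
        rw [sub_mul, (h.kkt i a).2, zero_sub]
      refine le_of_le_of_eq ?_ hslack.symm
      exact neg_nonneg.2 (mul_nonpos_of_nonneg_of_nonpos (h.nonneg a i) (h.kkt i a).1)
  have hback : R i = R (i + 1) + vecMulVec (F'.col i - F.col i) (G.col i) := by
    rw [h.residual_succ i, add_assoc, ← add_vecMulVec, sub_add_sub_cancel, sub_self,
      zero_vecMulVec, add_zero]
  rw [hback, frobSq_add, trace_transpose_mul_vecMulVec, frobSq_vecMulVec,
    ← neg_sub (F.col i), neg_dotProduct_neg]
  rw [← neg_sub (F.col i)] at hcross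
  linarith

lemma sum_le_frobSq_sub (h : IsHALSSweep R F F' G) :
    ∑ i, ((F.col i - F'.col i) ⬝ᵥ (F.col i - F'.col i)) * (G.col i ⬝ᵥ G.col i)
      ≤ frobSq (R 0) - frobSq (R k) := by
  calc _ ≤ ∑ i : Fin k, (frobSq (R i) - frobSq (R (i + 1))) :=
        Finset.sum_le_sum fun i _ => le_sub_iff_add_le'.2 (h.frobSq_succ_add_le i)
    _ = frobSq (R 0) - frobSq (R k) := by
        rw [Fin.sum_univ_eq_sum_range (fun i => frobSq (R i) - frobSq (R (i + 1))),
          Finset.sum_range_sub']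

lemma frobSq_last_le (h : IsHALSSweep R F F' G) : frobSq (R k) ≤ frobSq (R 0) := by
  refine sub_nonneg.1 (le_trans (Finset.sum_nonneg fun i _ => ?_) h.sum_le_frobSq_sub)
  exact mul_nonneg (dotProduct_self_star_nonneg (F.col i - F'.col i))
    (dotProduct_self_star_nonneg (G.col i))

lemma sq_sub_mul_le (h : IsHALSSweep R F F' G) (a : Fin m) (i : Fin k) :
    (F a i - F' a i) ^ 2 * (G.col i ⬝ᵥ G.col i) ≤ frobSq (R 0) - frobSq (R k) := by
  have hentry : (F a i - F' a i) ^ 2 ≤ (F.col i - F'.col i) ⬝ᵥ (F.col i - F'.col i) := by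
    rw [sq]
    exact Finset.single_le_sum
      (f := fun b => (F.col i - F'.col i) b * (F.col i - F'.col i) b)
      (fun _ _ => mul_self_nonneg _) (Finset.mem_univ a)
  calc (F a i - F' a i) ^ 2 * (G.col i ⬝ᵥ G.col i)
      ≤ ((F.col i - F'.col i) ⬝ᵥ (F.col i - F'.col i)) * (G.col i ⬝ᵥ G.col i) :=
        mul_le_mul_of_nonneg_right hentry (dotProduct_self_star_nonneg (G.col i))
    _ ≤ ∑ j, ((F.col j - F'.col j) ⬝ᵥ (F.col j - F'.col j)) * (G.col j ⬝ᵥ G.col j) :=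
        Finset.single_le_sum
          (f := fun j => ((F.col j - F'.col j) ⬝ᵥ (F.col j - F'.col j)) * (G.col j ⬝ᵥ G.col j))
          (fun j _ => mul_nonneg (dotProduct_self_star_nonneg (F.col j - F'.col j))
            (dotProduct_self_star_nonneg (G.col j))) (Finset.mem_univ i)
    _ ≤ frobSq (R 0) - frobSq (R k) := h.sum_le_frobSq_sub

end Descent

section Limit

variable {ι : Type*} {l : Filter ι} {R : ι → ℕ → Matrix (Fin m) (Fin n) ℝ}
  {F F' : ι → Matrix (Fin m) (Fin k) ℝ} {G : ι → Matrix (Fin n) (Fin k) ℝ}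
  {Flim : Matrix (Fin m) (Fin k) ℝ} {Glim : Matrix (Fin n) (Fin k) ℝ}
  {Rlim : Matrix (Fin m) (Fin n) ℝ}

lemma tendsto_updated (h : ∀ t, IsHALSSweep (R t) (F t) (F' t) (G t))
    (hF : Tendsto F l (𝓝 Flim)) (hG : Tendsto G l (𝓝 Glim)) (hG0 : ∀ i, Glim.col i ≠ 0)
    (hgap : Tendsto (fun t => frobSq (R t 0) - frobSq (R t k)) l (𝓝 0)) :
    Tendsto F' l (𝓝 Flim) := by
  refine tendsto_pi_nhds.2 fun a => tendsto_pi_nhds.2 fun i => ?_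
  have hnorm : Tendsto (fun t => (G t).col i ⬝ᵥ (G t).col i) l (𝓝 (Glim.col i ⬝ᵥ Glim.col i)) := by
    have hcont : Continuous fun M : Matrix (Fin n) (Fin k) ℝ => M.col i ⬝ᵥ M.col i := by
      fun_prop
    exact (hcont.tendsto Glim).comp hG
  have hpos : 0 < Glim.col i ⬝ᵥ Glim.col i := dotProduct_self_star_pos_iff.2 (hG0 i)
  have hquot := hgap.div hnorm hpos.ne'
  rw [zero_div] at hquot
  have hsq : Tendsto (fun t => (F t a i - F' t a i) ^ 2) l (𝓝 0) := by
    refine squeeze_zero' (Eventually.of_forall fun t => sq_nonneg _) ?_ hquot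
    filter_upwards [hnorm.eventually (lt_mem_nhds hpos)] with t ht
    exact (le_div_iff₀ ht).2 ((h t).sq_sub_mul_le a i)
  have hsub : Tendsto (fun t => F t a i - F' t a i) l (𝓝 0) := by
    rw [tendsto_zero_iff_abs_tendsto_zero]
    simpa [Real.sqrt_sq_eq_abs, Function.comp_def] using hsq.sqrt
  simpa using ((hF.apply_nhds a).apply_nhds i).sub hsub

lemma tendsto_residual (h : ∀ t, IsHALSSweep (R t) (F t) (F' t) (G t))
    (hF : Tendsto F l (𝓝 Flim)) (hF' : Tendsto F' l (𝓝 Flim)) (hG : Tendsto G l (𝓝 Glim))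
    (hR : Tendsto (fun t => R t 0) l (𝓝 Rlim)) {i : ℕ} (hi : i ≤ k) :
    Tendsto (fun t => R t i) l (𝓝 Rlim) := by
  induction i with
  | zero => exact hR
  | succ i ih =>
    have hcont : Continuous fun p : Matrix (Fin m) (Fin k) ℝ × Matrix (Fin m) (Fin k) ℝ ×
        Matrix (Fin n) (Fin k) ℝ =>
        vecMulVec (p.1.col ⟨i, hi⟩ - p.2.1.col ⟨i, hi⟩) (p.2.2.col ⟨i, hi⟩) := by fun_prop
    have hstep := (ih (by omega)).add
      ((hcont.tendsto _).comp (hF.prodMk_nhds (hF'.prodMk_nhds hG)))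
    simp only [sub_self, zero_vecMulVec, add_zero] at hstep
    exact hstep.congr fun t => ((h t).residual_succ ⟨i, hi⟩).symm

lemma isKKT_of_tendsto [l.NeBot] (h : ∀ t, IsHALSSweep (R t) (F t) (F' t) (G t))
    (hF : Tendsto F l (𝓝 Flim)) (hF' : Tendsto F' l (𝓝 Flim)) (hG : Tendsto G l (𝓝 Glim))
    (hR : Tendsto (fun t => R t 0) l (𝓝 Rlim)) : IsKKT Rlim Flim Glim := by
  intro a i
  have hRi := tendsto_residual h hF hF' hG hR (i := i + 1) i.2
  have hgrad : Tendsto (fun t => (R t (i + 1) * G t) a i) l (𝓝 ((Rlim * Glim) a i)) := by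
    have hcont : Continuous fun p : Matrix (Fin m) (Fin n) ℝ × Matrix (Fin n) (Fin k) ℝ =>
        (p.1 * p.2) a i := by fun_prop
    exact (hcont.tendsto _).comp (hRi.prodMk_nhds hG)
  refine ⟨le_of_tendsto' hgrad fun t => ((h t).kkt i a).1, ?_⟩
  refine tendsto_nhds_unique (((hF'.apply_nhds a).apply_nhds i).mul hgrad) ?_
  exact tendsto_const_nhds.congr fun t => ((h t).kkt i a).2.symm

end Limit

end IsHALSSweep

end Sweep

section DirectionalDerivative

lemma exists_eventually_posPart_add_mul_eq (u d : ℝ) : ∃ e : ℝ, (max 0 u = 0 → 0 ≤ e) ∧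
    ∀ᶠ s : ℝ in 𝓝[>] 0, max 0 (u + s * d) = max 0 u + s * e := by
  have hlim : Tendsto (fun s : ℝ => u + s * d) (𝓝[>] 0) (𝓝 u) := by
    have hcont : Continuous fun s : ℝ => u + s * d := by fun_prop
    simpa using (hcont.tendsto 0).mono_left nhdsWithin_le_nhds
  rcases lt_trichotomy u 0 with hu | rfl | hu
  · refine ⟨0, fun _ => le_rfl, ?_⟩
    filter_upwards [hlim.eventually (gt_mem_nhds hu)] with s hs
    rw [max_eq_left hs.le, max_eq_left hu.le, mul_zero, add_zero]
  · refine ⟨max 0 d, fun _ => le_max_left 0 d, ?_⟩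
    filter_upwards [self_mem_nhdsWithin] with s hs
    rw [zero_add, max_self, zero_add, mul_max_of_nonneg _ _ (le_of_lt hs), mul_zero]
  · refine ⟨d, fun h => absurd h (lt_max_of_lt_right hu).ne', ?_⟩
    filter_upwards [hlim.eventually (lt_mem_nhds hu)] with s hs
    rw [max_eq_right hs.le, max_eq_right hu.le]

lemma exists_eventually_factorMatrix_add_smul_eq {n d k : ℕ} (X : Matrix (Fin n) (Fin d) ℝ)
    (f g : Fin k → (Fin d → ℝ) → ℝ) :
    ∃ D : Matrix (Fin n) (Fin k) ℝ, (∀ a i, factorMatrix X f a i = 0 → 0 ≤ D a i) ∧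
      ∀ᶠ s : ℝ in 𝓝[>] 0, factorMatrix X (f + s • g) = factorMatrix X f + s • D := by
  choose D hD0 hD using fun (a : Fin n) (i : Fin k) =>
    exists_eventually_posPart_add_mul_eq (f i (X a)) (g i (X a))
  refine ⟨of D, hD0, ?_⟩
  filter_upwards [eventually_all.2 fun a => eventually_all.2 fun i => hD a i] with s hs
  ext a i
  exact hs a i

lemma IsKKT.trace_nonpos {m n k : ℕ} {R : Matrix (Fin m) (Fin n) ℝ}
    {F D : Matrix (Fin m) (Fin k) ℝ} {G : Matrix (Fin n) (Fin k) ℝ} (h : IsKKT R F G)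
    (hD : ∀ a i, F a i = 0 → 0 ≤ D a i) : (Rᵀ * (D * Gᵀ)).trace ≤ 0 := by
  have hsum : (Rᵀ * (D * Gᵀ)).trace = ∑ i, ∑ a, (R * G) a i * D a i := by
    rw [← Matrix.mul_assoc, trace_mul_cycle, ← transpose_mul]
    simp only [trace, diag_apply, mul_apply (M := (R * G)ᵀ), transpose_apply]
  rw [hsum]
  refine Finset.sum_nonpos fun i _ => Finset.sum_nonpos fun a _ => ?_
  obtain ⟨hneg, hslack⟩ := h a i
  rcases mul_eq_zero.1 hslack with hF | hRG
  · exact mul_nonpos_of_nonpos_of_nonneg hneg (hD a i hF)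
  · rw [hRG, zero_mul]

variable {n₁ n₂ d₁ d₂ k : ℕ} {Xr : Matrix (Fin n₁) (Fin d₁) ℝ} {Xc : Matrix (Fin n₂) (Fin d₂) ℝ}

lemma tendsto_objective_slope {x y : Variables n₁ n₂ d₁ d₂ k}
    {D : Matrix (Fin n₁) (Fin k) ℝ} {E : Matrix (Fin n₂) (Fin k) ℝ}
    (hD : ∀ᶠ s : ℝ in 𝓝[>] 0, factorMatrix Xr (x.2.1 + s • y.2.1) = factorMatrix Xr x.2.1 + s • D)
    (hE : ∀ᶠ s : ℝ in 𝓝[>] 0, factorMatrix Xc (x.2.2 + s • y.2.2) = factorMatrix Xc x.2.2 + s • E) :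
    Tendsto (fun s : ℝ => (objective Xr Xc (x + s • y) - objective Xr Xc x) / s) (𝓝[>] 0)
      (𝓝 (2 * ((x.1 - factorMatrix Xr x.2.1 * (factorMatrix Xc x.2.2)ᵀ)ᵀ *
        (y.1 - D * (factorMatrix Xc x.2.2)ᵀ - factorMatrix Xr x.2.1 * Eᵀ)).trace)) := by
  set F := factorMatrix Xr x.2.1
  set G := factorMatrix Xc x.2.2
  have hdir : Tendsto (fun s : ℝ => y.1 - D * Gᵀ - F * Eᵀ - s • (D * Eᵀ)) (𝓝[>] 0)
      (𝓝 (y.1 - D * Gᵀ - F * Eᵀ)) := by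
    have hcont : Continuous fun s : ℝ => y.1 - D * Gᵀ - F * Eᵀ - s • (D * Eᵀ) := by fun_prop
    simpa using (hcont.tendsto 0).mono_left nhdsWithin_le_nhds
  refine (tendsto_frobSq_slope _ hdir).congr' ?_
  filter_upwards [hD, hE] with s hDs hEs
  have hexpand : x.1 + s • y.1 - (F + s • D) * (G + s • E)ᵀ
      = x.1 - F * Gᵀ + s • (y.1 - D * Gᵀ - F * Eᵀ - s • (D * Eᵀ)) := by
    simp only [transpose_add, transpose_smul, Matrix.add_mul, Matrix.mul_add, Matrix.smul_mul,
      Matrix.mul_smul]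
    module
  simp only [objective, Prod.fst_add, Prod.snd_add, Prod.smul_fst, Prod.smul_snd, hDs, hEs, hexpand]
  rfl

theorem isCriticalPointOn_of_isKKT {N : ℕ}
    {A : Matrix (Fin n₁) (Fin n₂) ℝ →ₗ[ℝ] (Fin N → ℝ)} {b : Fin N → ℝ}
    {Sr : Set ((Fin d₁ → ℝ) → ℝ)} {Sc : Set ((Fin d₂ → ℝ) → ℝ)}
    {V R : Matrix (Fin n₁) (Fin n₂) ℝ} {fr : Fin k → (Fin d₁ → ℝ) → ℝ}
    {fc : Fin k → (Fin d₂ → ℝ) → ℝ} (hx : (V, fr, fc) ∈ feasibleSet A b Sr Sc k)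
    (hR : R = V - factorMatrix Xr fr * (factorMatrix Xc fc)ᵀ)
    (hV : ∀ W ∈ feasibleMatrices A b, 0 ≤ (Rᵀ * (W - V)).trace)
    (hr : IsKKT R (factorMatrix Xr fr) (factorMatrix Xc fc))
    (hc : IsKKT Rᵀ (factorMatrix Xc fc) (factorMatrix Xr fr)) :
    IsCriticalPointOn (objective Xr Xc) (feasibleSet A b Sr Sc k) (V, fr, fc) := by
  refine ⟨hx, fun ⟨W, gr, gc⟩ hy => ?_⟩
  obtain ⟨D, hD0, hD⟩ := exists_eventually_factorMatrix_add_smul_eq Xr fr (gr - fr)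
  obtain ⟨E, hE0, hE⟩ := exists_eventually_factorMatrix_add_smul_eq Xc fc (gc - fc)
  refine ⟨_, ?_, tendsto_objective_slope hD hE⟩
  have hrow : (Rᵀ * (D * (factorMatrix Xc fc)ᵀ)).trace ≤ 0 := hr.trace_nonpos hD0
  have hcol : (Rᵀ * (factorMatrix Xr fr * Eᵀ)).trace ≤ 0 := by
    rw [← trace_transpose_mul Rᵀ, transpose_mul, transpose_transpose E]
    exact hc.trace_nonpos hE0
  have hVW : 0 ≤ (Rᵀ * (W - V)).trace := hV W hy.1
  change 0 ≤ 2 * ((V - factorMatrix Xr fr * (factorMatrix Xc fc)ᵀ)ᵀ *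
    ((W - V) - D * (factorMatrix Xc fc)ᵀ - factorMatrix Xr fr * Eᵀ)).trace
  rw [← hR, Matrix.mul_sub, Matrix.mul_sub, trace_sub, trace_sub]
  linarith

end DirectionalDerivative

section Constraints

lemma factorMatrix_nonneg {n d k : ℕ} (X : Matrix (Fin n) (Fin d) ℝ)
    (f : Fin k → (Fin d → ℝ) → ℝ) (a : Fin n) (i : Fin k) : 0 ≤ factorMatrix X f a i :=
  le_max_left _ _

lemma continuous_factorMatrix {n d k : ℕ} (X : Matrix (Fin n) (Fin d) ℝ) :
    Continuous (factorMatrix (k := k) X) :=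
  continuous_matrix fun a i => continuous_const.max (continuous_apply_apply i (X a))

lemma exists_factorMatrix_eq {n d k : ℕ} {X : Matrix (Fin n) (Fin d) ℝ}
    {S : Set ((Fin d → ℝ) → ℝ)} (hS : Set.SurjOn (evalRows X) S Set.univ)
    {F : Matrix (Fin n) (Fin k) ℝ} (hF : ∀ a i, 0 ≤ F a i) :
    ∃ f : Fin k → (Fin d → ℝ) → ℝ, (∀ i, f i ∈ S) ∧ factorMatrix X f = F := by
  choose f hfS hf using fun i => hS (Set.mem_univ (F.col i))
  refine ⟨f, hfS, ?_⟩
  ext a i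
  simp [factorMatrix, hf, hF a i]

variable {n₁ n₂ N : ℕ} (A : Matrix (Fin n₁) (Fin n₂) ℝ →ₗ[ℝ] (Fin N → ℝ)) (b : Fin N → ℝ)

lemma isClosed_feasibleMatrices : IsClosed (feasibleMatrices A b) := by
  have hA : Continuous A := A.continuous_of_finiteDimensional
  exact (isClosed_singleton.preimage hA).inter (isClosed_Ici (a := (0 : Fin n₁ → Fin n₂ → ℝ)))

lemma convex_feasibleMatrices : Convex ℝ (feasibleMatrices A b) :=
  ((convex_singleton b).linear_preimage A).inter (convex_Ici (0 : Fin n₁ → Fin n₂ → ℝ))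

end Constraints

section LinkFunctions

lemma isClosed_range_of_finiteDimensional {E F : Type*} [AddCommGroup E] [Module ℝ E]
    [FiniteDimensional ℝ E] [AddCommGroup F] [Module ℝ F] [TopologicalSpace F]
    [IsTopologicalAddGroup F] [ContinuousSMul ℝ F] [T2Space F] (φ : E →ₗ[ℝ] F) :
    IsClosed (Set.range φ) := by
  rw [← LinearMap.coe_range]
  exact Submodule.closed_of_finiteDimensional _

lemma IsFullRank.col_ne_zero {n k : ℕ} (hkn : k ≤ n) {F : Matrix (Fin n) (Fin k) ℝ}
    (hF : IsFullRank F) (i : Fin k) : F.col i ≠ 0 := by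
  have hindep : LinearIndependent ℝ F.col := by
    rw [linearIndependent_iff_card_eq_finrank_span, Set.finrank, ← rank_eq_finrank_span_cols,
      hF, min_eq_right hkn, Fintype.card_fin]
  exact hindep.ne_zero i

lemma jacobian_linearMap {r n : ℕ} (L : (Fin r → ℝ) →ₗ[ℝ] (Fin n → ℝ)) (θ : Fin r → ℝ) :
    jacobian L θ = LinearMap.toMatrix' L := by
  rw [jacobian, ← LinearMap.coe_toContinuousLinearMap' L, ContinuousLinearMap.fderiv,
    LinearMap.coe_toContinuousLinearMap]

lemma surjective_of_isFullRank_toMatrix' {r n : ℕ} (hnr : n ≤ r)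
    {L : (Fin r → ℝ) →ₗ[ℝ] (Fin n → ℝ)} (hL : IsFullRank (LinearMap.toMatrix' L)) :
    Function.Surjective L := by
  rw [IsFullRank, min_eq_left hnr, Matrix.rank, ← toLin'_apply', toLin'_toMatrix'] at hL
  refine LinearMap.range_eq_top.1 (Submodule.eq_top_of_finrank_eq ?_)
  rw [hL, Module.finrank_fin_fun]

lemma surjOn_evalRows_range {n d r : ℕ} (hnr : n ≤ r) {X : Matrix (Fin n) (Fin d) ℝ}
    {φ : (Fin r → ℝ) →ₗ[ℝ] ((Fin d → ℝ) → ℝ)} {θ : Fin r → ℝ}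
    (hJ : IsFullRank (jacobian (fun η => evalRows X (φ η)) θ)) :
    Set.SurjOn (evalRows X) (Set.range φ) Set.univ := by
  let L : (Fin r → ℝ) →ₗ[ℝ] (Fin n → ℝ) := (LinearMap.funLeft ℝ ℝ X).comp φ
  have hL : IsFullRank (LinearMap.toMatrix' L) := by
    rw [← jacobian_linearMap L θ]
    exact hJ
  intro u _
  obtain ⟨η, hη⟩ := surjective_of_isFullRank_toMatrix' hnr hL u
  exact ⟨φ η, ⟨η, rfl⟩, hη⟩

end LinkFunctions

namespace HALSXRun

variable {n₁ n₂ N d₁ d₂ k : ℕ} {A : Matrix (Fin n₁) (Fin n₂) ℝ →ₗ[ℝ] (Fin N → ℝ)}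
  {b : Fin N → ℝ} {Xr : Matrix (Fin n₁) (Fin d₁) ℝ} {Xc : Matrix (Fin n₂) (Fin d₂) ℝ}
  {Sr : Set ((Fin d₁ → ℝ) → ℝ)} {Sc : Set ((Fin d₂ → ℝ) → ℝ)}
  (run : HALSXRun A b Xr Xc Sr Sc k)

lemma eventually_fr_mem : ∀ᶠ t in atTop, ∀ i, run.fr t i ∈ Sr := by
  rw [← map_add_atTop_eq_nat 1]
  exact eventually_map.2 (Eventually.of_forall fun t i => (run.fr_argmin t i).1)

lemma eventually_fc_mem : ∀ᶠ t in atTop, ∀ i, run.fc t i ∈ Sc := by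
  rw [← map_add_atTop_eq_nat 1]
  exact eventually_map.2 (Eventually.of_forall fun t i => (run.fc_argmin t i).1)

lemma eventually_factorMatrix_fr_eq : ∀ᶠ t in atTop, factorMatrix Xr (run.fr t) = run.Fr t := by
  rw [← map_add_atTop_eq_nat 1]
  exact eventually_map.2 (Eventually.of_forall fun t => (run.Fr_succ t).symm)

lemma eventually_factorMatrix_fc_eq : ∀ᶠ t in atTop, factorMatrix Xc (run.fc t) = run.Fc t := by
  rw [← map_add_atTop_eq_nat 1]
  exact eventually_map.2 (Eventually.of_forall fun t => (run.Fc_succ t).symm)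

lemma Fr_nonneg (t : ℕ) (a : Fin n₁) (i : Fin k) : 0 ≤ run.Fr t a i := by
  cases t with
  | zero => exact run.Fr_zero_nonneg a i
  | succ t => exact run.Fr_succ t ▸ factorMatrix_nonneg Xr _ a i

lemma Fc_nonneg (t : ℕ) (a : Fin n₂) (i : Fin k) : 0 ≤ run.Fc t a i := by
  cases t with
  | zero => exact run.Fc_zero_nonneg a i
  | succ t => exact run.Fc_succ t ▸ factorMatrix_nonneg Xc _ a i

section Sweeps

variable (hSr : Set.SurjOn (evalRows Xr) Sr Set.univ) (hSc : Set.SurjOn (evalRows Xc) Sc Set.univ)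

include hSr in
lemma isHALSSweep_row (t : ℕ) :
    IsHALSSweep (run.Rr t) (run.Fr t) (run.Fr (t + 1)) (run.Fc t) := by
  refine .of_isMinOn (U := fun i => evalRows Xr (run.fr (t + 1) i)) (run.Fr_nonneg t)
    (fun i w hw => ?_) (fun a i => by rw [run.Fr_succ]; rfl) (run.Rr_succ t)
  obtain ⟨f, hf, rfl⟩ := hSr hw
  exact (run.fr_argmin t i).2 hf

include hSc in
lemma isHALSSweep_col (t : ℕ) :
    IsHALSSweep (fun i => (run.Rc t i)ᵀ) (run.Fc t) (run.Fc (t + 1)) (run.Fr (t + 1)) := by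
  refine .of_isMinOn (U := fun i => evalRows Xc (run.fc (t + 1) i)) (run.Fc_nonneg t)
    (fun i w hw => ?_) (fun a i => by rw [run.Fc_succ]; rfl) (fun i => ?_)
  · obtain ⟨f, hf, rfl⟩ := hSc hw
    change frobSq _ ≤ frobSq _
    simp only [← transpose_vecMulVec ((run.Fr (t + 1)).col i), ← transpose_add, ← transpose_sub,
      frobSq_transpose]
    exact (run.fc_argmin t i).2 hf
  · simp only [run.Rc_succ t i, transpose_sub, transpose_add, transpose_vecMulVec]

include hSc in
lemma frobSq_Rc_last_le (t : ℕ) : frobSq (run.Rc t k) ≤ frobSq (run.Rr t k) := by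
  simpa only [frobSq_transpose, run.Rc_zero] using (run.isHALSSweep_col hSc t).frobSq_last_le

include hSr hSc

lemma Rc_last (t : ℕ) : run.Rc t k = run.V t - run.Fr (t + 1) * (run.Fc (t + 1))ᵀ := by
  have hrow := (run.isHALSSweep_row hSr t).residual_last
  have hcol := congrArg transpose (run.isHALSSweep_col hSc t).residual_last
  simp only [transpose_add, transpose_mul, transpose_transpose] at hcol
  rw [hcol, run.Rc_zero, hrow, run.Rr_zero, transpose_sub, Matrix.sub_mul, Matrix.mul_sub]
  abel

lemma frobSq_Rr_succ_le (t : ℕ) : frobSq (run.Rr (t + 1) 0) ≤ frobSq (run.Rc t k) := by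
  rw [run.Rc_last hSr hSc, run.Rr_zero]
  exact (run.V_argmin (t + 1)).2 (run.V_argmin t).1

lemma tendsto_frobSq_Rr_sub_succ :
    Tendsto (fun t => frobSq (run.Rr t 0) - frobSq (run.Rr (t + 1) 0)) atTop (𝓝 0) := by
  have hanti : Antitone fun t => frobSq (run.Rr t 0) := antitone_nat_of_succ_le fun t =>
    calc frobSq (run.Rr (t + 1) 0) ≤ frobSq (run.Rc t k) := run.frobSq_Rr_succ_le hSr hSc t
      _ ≤ frobSq (run.Rr t k) := run.frobSq_Rc_last_le hSc t
      _ ≤ frobSq (run.Rr t 0) := (run.isHALSSweep_row hSr t).frobSq_last_le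
  have hbdd : BddBelow (Set.range fun t => frobSq (run.Rr t 0)) :=
    ⟨0, Set.forall_mem_range.2 fun _ => frobSq_nonneg _⟩
  have hlim := tendsto_atTop_ciInf hanti hbdd
  simpa using hlim.sub ((tendsto_add_atTop_iff_nat 1).2 hlim)

lemma tendsto_row_decrease :
    Tendsto (fun t => frobSq (run.Rr t 0) - frobSq (run.Rr t k)) atTop (𝓝 0) :=
  squeeze_zero (fun t => sub_nonneg.2 (run.isHALSSweep_row hSr t).frobSq_last_le)
    (fun t => sub_le_sub_left
      ((run.frobSq_Rr_succ_le hSr hSc t).trans (run.frobSq_Rc_last_le hSc t)) _)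
    (run.tendsto_frobSq_Rr_sub_succ hSr hSc)

lemma tendsto_col_decrease :
    Tendsto (fun t => frobSq (run.Rc t 0) - frobSq (run.Rc t k)) atTop (𝓝 0) := by
  refine squeeze_zero (fun t => ?_) (fun t => ?_) (run.tendsto_frobSq_Rr_sub_succ hSr hSc)
  · rw [run.Rc_zero]
    exact sub_nonneg.2 (run.frobSq_Rc_last_le hSc t)
  · rw [run.Rc_zero]
    exact sub_le_sub (run.isHALSSweep_row hSr t).frobSq_last_le (run.frobSq_Rr_succ_le hSr hSc t)

end Sweeps

section Limit

variable {l : Filter ℕ} {V : Matrix (Fin n₁) (Fin n₂) ℝ} {F : Matrix (Fin n₁) (Fin k) ℝ}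
  {G : Matrix (Fin n₂) (Fin k) ℝ}

lemma tendsto_Rr_zero (hV : Tendsto run.V l (𝓝 V)) (hFr : Tendsto run.Fr l (𝓝 F))
    (hFc : Tendsto run.Fc l (𝓝 G)) : Tendsto (fun t => run.Rr t 0) l (𝓝 (V - F * Gᵀ)) := by
  simp only [run.Rr_zero]
  have hcont : Continuous fun p : Matrix (Fin n₁) (Fin n₂) ℝ × Matrix (Fin n₁) (Fin k) ℝ ×
      Matrix (Fin n₂) (Fin k) ℝ => p.1 - p.2.1 * p.2.2ᵀ := by fun_prop
  exact (hcont.tendsto _).comp (hV.prodMk_nhds (hFr.prodMk_nhds hFc))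

lemma trace_nonneg_of_tendsto [l.NeBot] (hV : Tendsto run.V l (𝓝 V))
    (hFr : Tendsto run.Fr l (𝓝 F)) (hFc : Tendsto run.Fc l (𝓝 G))
    {W : Matrix (Fin n₁) (Fin n₂) ℝ} (hW : W ∈ feasibleMatrices A b) :
    0 ≤ ((V - F * Gᵀ)ᵀ * (W - V)).trace := by
  have hcont : Continuous fun p : Matrix (Fin n₁) (Fin n₂) ℝ × Matrix (Fin n₁) (Fin n₂) ℝ =>
      (p.1ᵀ * (W - p.2)).trace := by fun_prop
  have hlim := (hcont.tendsto _).comp ((run.tendsto_Rr_zero hV hFr hFc).prodMk_nhds hV)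
  refine ge_of_tendsto' hlim fun t => ?_
  simp only [Function.comp_apply, run.Rr_zero]
  exact trace_nonneg_of_isArgminOn (convex_feasibleMatrices A b) (run.V_argmin t) hW

lemma isKKT_of_tendsto (hSr : Set.SurjOn (evalRows Xr) Sr Set.univ)
    (hSc : Set.SurjOn (evalRows Xc) Sc Set.univ) [l.NeBot] (hl : l ≤ atTop)
    (hV : Tendsto run.V l (𝓝 V)) (hFr : Tendsto run.Fr l (𝓝 F)) (hFc : Tendsto run.Fc l (𝓝 G))
    (hF0 : ∀ i, F.col i ≠ 0) (hG0 : ∀ i, G.col i ≠ 0) :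
    IsKKT (V - F * Gᵀ) F G ∧ IsKKT (V - F * Gᵀ)ᵀ G F := by
  have hrow := run.isHALSSweep_row hSr
  have hcol := run.isHALSSweep_col hSc
  have hR := run.tendsto_Rr_zero hV hFr hFc
  have hFr' : Tendsto (fun t => run.Fr (t + 1)) l (𝓝 F) :=
    IsHALSSweep.tendsto_updated hrow hFr hFc hG0 ((run.tendsto_row_decrease hSr hSc).mono_left hl)
  have hFc' : Tendsto (fun t => run.Fc (t + 1)) l (𝓝 G) := by
    refine IsHALSSweep.tendsto_updated hcol hFc hFr' hF0 ?_
    simp only [frobSq_transpose]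
    exact (run.tendsto_col_decrease hSr hSc).mono_left hl
  have hRc : Tendsto (fun t => (run.Rc t 0)ᵀ) l (𝓝 (V - F * Gᵀ)ᵀ) := by
    simp only [run.Rc_zero]
    exact (continuous_id.matrix_transpose.tendsto _).comp
      (IsHALSSweep.tendsto_residual hrow hFr hFr' hFc hR le_rfl)
  exact ⟨IsHALSSweep.isKKT_of_tendsto hrow hFr hFr' hFc hR,
    IsHALSSweep.isKKT_of_tendsto hcol hFc hFc' hFr' hRc⟩

theorem isCriticalPointOn_of_tendsto (hSr : Set.SurjOn (evalRows Xr) Sr Set.univ)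
    (hSc : Set.SurjOn (evalRows Xc) Sc Set.univ) [l.NeBot] (hl : l ≤ atTop)
    {fr : Fin k → (Fin d₁ → ℝ) → ℝ} {fc : Fin k → (Fin d₂ → ℝ) → ℝ}
    (hfr : ∀ i, fr i ∈ Sr) (hfc : ∀ i, fc i ∈ Sc) (hV : Tendsto run.V l (𝓝 V))
    (hFr : Tendsto run.Fr l (𝓝 (factorMatrix Xr fr)))
    (hFc : Tendsto run.Fc l (𝓝 (factorMatrix Xc fc)))
    (hFr0 : ∀ i, (factorMatrix Xr fr).col i ≠ 0) (hFc0 : ∀ i, (factorMatrix Xc fc).col i ≠ 0) :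
    IsCriticalPointOn (objective Xr Xc) (feasibleSet A b Sr Sc k) (V, fr, fc) := by
  have hVmem : V ∈ feasibleMatrices A b :=
    (isClosed_feasibleMatrices A b).mem_of_tendsto hV
      (Eventually.of_forall fun t => (run.V_argmin t).1)
  obtain ⟨hr, hc⟩ := run.isKKT_of_tendsto hSr hSc hl hV hFr hFc hFr0 hFc0
  exact isCriticalPointOn_of_isKKT ⟨hVmem, hfr, hfc⟩ rfl
    (fun W hW => run.trace_nonneg_of_tendsto hV hFr hFc hW) hr hc

end Limit

section ClusterPoint

variable {V : Matrix (Fin n₁) (Fin n₂) ℝ} {F : Matrix (Fin n₁) (Fin k) ℝ}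
  {G : Matrix (Fin n₂) (Fin k) ℝ} {fr : Fin k → (Fin d₁ → ℝ) → ℝ} {fc : Fin k → (Fin d₂ → ℝ) → ℝ}

lemma isCriticalPointOn_of_mapClusterPt_factors (hSr : Set.SurjOn (evalRows Xr) Sr Set.univ)
    (hSc : Set.SurjOn (evalRows Xc) Sc Set.univ)
    (hx : MapClusterPt (V, factorMatrix Xr fr, factorMatrix Xc fc) atTop
      (fun t => (run.V t, run.Fr t, run.Fc t)))
    (hfr : ∀ i, fr i ∈ Sr) (hfc : ∀ i, fc i ∈ Sc)
    (hFr0 : ∀ i, (factorMatrix Xr fr).col i ≠ 0) (hFc0 : ∀ i, (factorMatrix Xc fc).col i ≠ 0) :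
    IsCriticalPointOn (objective Xr Xc) (feasibleSet A b Sr Sc k) (V, fr, fc) := by
  obtain ⟨l, hl, hlim⟩ := mapClusterPt_iff_ultrafilter.1 hx
  exact run.isCriticalPointOn_of_tendsto hSr hSc hl hfr hfc hlim.fst_nhds
    hlim.snd_nhds.fst_nhds hlim.snd_nhds.snd_nhds hFr0 hFc0

lemma mem_of_mapClusterPt_links (hSr : IsClosed Sr) (hSc : IsClosed Sc)
    (hx : MapClusterPt (V, fr, fc) atTop (fun t => (run.V t, run.fr t, run.fc t))) :
    (∀ i, fr i ∈ Sr) ∧ ∀ i, fc i ∈ Sc := by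
  obtain ⟨l, hl, hlim⟩ := mapClusterPt_iff_ultrafilter.1 hx
  exact ⟨fun i => hSr.mem_of_tendsto (hlim.snd_nhds.fst_nhds.apply_nhds i)
      (hl (run.eventually_fr_mem.mono fun t ht => ht i)),
    fun i => hSc.mem_of_tendsto (hlim.snd_nhds.snd_nhds.apply_nhds i)
      (hl (run.eventually_fc_mem.mono fun t ht => ht i))⟩

lemma mapClusterPt_factors_of_links
    (hx : MapClusterPt (V, fr, fc) atTop (fun t => (run.V t, run.fr t, run.fc t))) :
    MapClusterPt (V, factorMatrix Xr fr, factorMatrix Xc fc) atTop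
      (fun t => (run.V t, run.Fr t, run.Fc t)) := by
  have hcont : Continuous fun x : Variables n₁ n₂ d₁ d₂ k =>
      (x.1, factorMatrix Xr x.2.1, factorMatrix Xc x.2.2) :=
    continuous_fst.prodMk (((continuous_factorMatrix Xr).comp continuous_snd.fst).prodMk
      ((continuous_factorMatrix Xc).comp continuous_snd.snd))
  have heq : (fun x : Variables n₁ n₂ d₁ d₂ k =>
      (x.1, factorMatrix Xr x.2.1, factorMatrix Xc x.2.2)) ∘
        (fun t => (run.V t, run.fr t, run.fc t)) =ᶠ[atTop]
      fun t => (run.V t, run.Fr t, run.Fc t) := by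
    filter_upwards [run.eventually_factorMatrix_fr_eq, run.eventually_factorMatrix_fc_eq]
      with t hr hc
    simp only [Function.comp_apply, hr, hc]
  rw [MapClusterPt, ← map_congr heq]
  exact hx.continuousAt_comp hcont.continuousAt

lemma nonneg_of_mapClusterPt_factors
    (hx : MapClusterPt (V, F, G) atTop (fun t => (run.V t, run.Fr t, run.Fc t))) :
    (∀ a i, 0 ≤ F a i) ∧ ∀ a i, 0 ≤ G a i := by
  obtain ⟨l, -, hlim⟩ := mapClusterPt_iff_ultrafilter.1 hx
  have hFr : Tendsto run.Fr l (𝓝 F) := hlim.snd_nhds.fst_nhds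
  have hFc : Tendsto run.Fc l (𝓝 G) := hlim.snd_nhds.snd_nhds
  exact ⟨fun a i => ge_of_tendsto' ((hFr.apply_nhds a).apply_nhds i) fun t => run.Fr_nonneg t a i,
    fun a i => ge_of_tendsto' ((hFc.apply_nhds a).apply_nhds i) fun t => run.Fc_nonneg t a i⟩

end ClusterPoint

end HALSXRun

theorem mainTheorem2_general {n₁ n₂ N d₁ d₂ k : ℕ}
    {A : Matrix (Fin n₁) (Fin n₂) ℝ →ₗ[ℝ] (Fin N → ℝ)} {b : Fin N → ℝ}
    {Xr : Matrix (Fin n₁) (Fin d₁) ℝ} {Xc : Matrix (Fin n₂) (Fin d₂) ℝ}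
    {Sr : Set ((Fin d₁ → ℝ) → ℝ)} {Sc : Set ((Fin d₂ → ℝ) → ℝ)}
    (hSr : Set.SurjOn (evalRows Xr) Sr Set.univ) (hSc : Set.SurjOn (evalRows Xc) Sc Set.univ)
    (hSr_closed : IsClosed Sr) (hSc_closed : IsClosed Sc)
    (run : HALSXRun A b Xr Xc Sr Sc k) :
    (∀ x : Variables n₁ n₂ d₁ d₂ k,
      MapClusterPt x atTop (fun t => (run.V t, run.fr t, run.fc t)) →
      (∀ i, (factorMatrix Xr x.2.1).col i ≠ 0) → (∀ i, (factorMatrix Xc x.2.2).col i ≠ 0) →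
      IsCriticalPointOn (objective Xr Xc) (feasibleSet A b Sr Sc k) x) ∧
    (∀ (V : Matrix (Fin n₁) (Fin n₂) ℝ) (Fr : Matrix (Fin n₁) (Fin k) ℝ)
        (Fc : Matrix (Fin n₂) (Fin k) ℝ),
      MapClusterPt (V, Fr, Fc) atTop (fun t => (run.V t, run.Fr t, run.Fc t)) →
      (∃ fr fc, (∀ i, fr i ∈ Sr) ∧ (∀ i, fc i ∈ Sc) ∧
        factorMatrix Xr fr = Fr ∧ factorMatrix Xc fc = Fc) ∧
      ((∀ i, Fr.col i ≠ 0) → (∀ i, Fc.col i ≠ 0) →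
        ∀ fr fc, (∀ i, fr i ∈ Sr) → (∀ i, fc i ∈ Sc) →
          factorMatrix Xr fr = Fr → factorMatrix Xc fc = Fc →
          IsCriticalPointOn (objective Xr Xc) (feasibleSet A b Sr Sc k) (V, fr, fc))) := by
  refine ⟨fun ⟨V, fr, fc⟩ hx hFr0 hFc0 => ?_, fun V Fr Fc hx => ⟨?_, ?_⟩⟩
  · obtain ⟨hfr, hfc⟩ := run.mem_of_mapClusterPt_links hSr_closed hSc_closed hx
    exact run.isCriticalPointOn_of_mapClusterPt_factors hSr hSc
      (run.mapClusterPt_factors_of_links hx) hfr hfc hFr0 hFc0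
  · obtain ⟨hFr, hFc⟩ := run.nonneg_of_mapClusterPt_factors hx
    obtain ⟨fr, hfr, hfrF⟩ := exists_factorMatrix_eq hSr hFr
    obtain ⟨fc, hfc, hfcF⟩ := exists_factorMatrix_eq hSc hFc
    exact ⟨fr, fc, hfr, hfc, hfrF, hfcF⟩
  · rintro hFr0 hFc0 fr fc hfr hfc rfl rfl
    exact run.isCriticalPointOn_of_mapClusterPt_factors hSr hSc hx hfr hfc hFr0 hFc0

theorem mainTheorem2 {n₁ n₂ N d₁ d₂ r₁ r₂ k : ℕ}
    (hk : 1 ≤ k) (hkn : k ≤ min n₁ n₂) (hr₁ : n₁ ≤ r₁) (hr₂ : n₂ ≤ r₂)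
    (A : Matrix (Fin n₁) (Fin n₂) ℝ →ₗ[ℝ] (Fin N → ℝ)) (b : Fin N → ℝ)
    (Xr : Matrix (Fin n₁) (Fin d₁) ℝ) (Xc : Matrix (Fin n₂) (Fin d₂) ℝ)
    -- the regression functions, linear in their parameters; the link functions are searched in
    -- the ranges of these two maps
    (φr : (Fin r₁ → ℝ) →ₗ[ℝ] ((Fin d₁ → ℝ) → ℝ))
    (φc : (Fin r₂ → ℝ) →ₗ[ℝ] ((Fin d₂ → ℝ) → ℝ))
    (hJr : ∀ θ, IsFullRank (jacobian (fun η => evalRows Xr (φr η)) θ))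
    (hJc : ∀ θ, IsFullRank (jacobian (fun η => evalRows Xc (φc η)) θ))
    (run : HALSXRun A b Xr Xc (Set.range φr) (Set.range φc) k) :
    -- limit points of the iterates `(V^t, f_r^t, f_c^t)`
    (∀ x : Variables n₁ n₂ d₁ d₂ k,
      MapClusterPt x atTop (fun t => (run.V t, run.fr t, run.fc t)) →
      IsFullRank (factorMatrix Xr x.2.1) → IsFullRank (factorMatrix Xc x.2.2) →
      IsCriticalPointOn (objective Xr Xc)
        (feasibleSet A b (Set.range φr) (Set.range φc) k) x) ∧
    -- limit points of the iterates `(V^t, F_r^t, F_c^t)`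
    (∀ (V : Matrix (Fin n₁) (Fin n₂) ℝ) (Fr : Matrix (Fin n₁) (Fin k) ℝ)
        (Fc : Matrix (Fin n₂) (Fin k) ℝ),
      MapClusterPt (V, Fr, Fc) atTop (fun t => (run.V t, run.Fr t, run.Fc t)) →
      IsFullRank Fr → IsFullRank Fc →
      (∃ fr fc, (∀ i, fr i ∈ Set.range φr) ∧ (∀ i, fc i ∈ Set.range φc) ∧
        factorMatrix Xr fr = Fr ∧ factorMatrix Xc fc = Fc) ∧
      ∀ fr fc, (∀ i, fr i ∈ Set.range φr) → (∀ i, fc i ∈ Set.range φc) →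
        factorMatrix Xr fr = Fr → factorMatrix Xc fc = Fc →
        IsCriticalPointOn (objective Xr Xc)
          (feasibleSet A b (Set.range φr) (Set.range φc) k) (V, fr, fc)) := by
  have hSr := surjOn_evalRows_range hr₁ (hJr 0)
  have hSc := surjOn_evalRows_range hr₂ (hJc 0)
  have hkr := hkn.trans (min_le_left n₁ n₂)
  have hkc := hkn.trans (min_le_right n₁ n₂)
  obtain ⟨hlinks, hfactors⟩ := mainTheorem2_general hSr hSc
    (isClosed_range_of_finiteDimensional φr) (isClosed_range_of_finiteDimensional φc) run
  exact ⟨fun x hx hr hc => hlinks x hx (hr.col_ne_zero hkr) (hc.col_ne_zero hkc),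
    fun V Fr Fc hx hr hc => (hfactors V Fr Fc hx).imp_right fun hcrit =>
      hcrit (hr.col_ne_zero hkr) (hc.col_ne_zero hkc)⟩
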